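/- Let $(\mathcal S,\mathcal A,P,r,\gamma)$ be a Markov decision process with finite state space $\mathcal S$, finite nonempty action space $\mathcal A$, transition probabilities $P(s'\mid s,a)$, reward function $r:\mathcal S\times\mathcal A\to\mathbb R$ and discount factor $\gamma\in[0,1)$. For a policy $\pi:\mathcal S\to\Delta(\mathcal A)$ let $Q^\pi(s,a)=\mathbb E_\pi\big[\sum_{t\ge 0}\gamma^t r(s_t,a_t)\mid s_0=s,a_0=a\big]$, and let $Q^*(s,a)=\sup_\pi Q^\pi(s,a)$. Fix $K\ge 1$ and a nonempty set $\mathcal T\subseteq\{0,\dots,K-1\}$ of historical time indices. For a state $s$ and historical values $Q_s=(Q_{sa}(j))_{a\in\mathcal A,\,0\le j<K}$ define the MINTO operator $$G(Q_s)=\max_{a\in\mathcal A}\min_{j\in\mathcal T}Q_{sa}(j).$$ On a probability space with a filtration $(\mathcal F_t)_{t\ge 0}$, let $Q(0),\dots,Q(K-1)\in\mathbb R^{\mathcal S\times\mathcal A}$ be arbitrary $\mathcal F_0$-measurable initial tables, and for all $t\ge 0$ and $(s,a)\in\mathcal S\times\mathcal A$ let $$Q_{sa}(t+K)=Q_{sa}(t+K-1)+\alpha_{sa}(t)\Big(r(s,a)+\gamma\max_{a'\in\mathcal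 A}\min_{j\in\mathcal T}Q_{s'a'}(t+j)-Q_{sa}(t+K-1)\Big),\qquad s'=X_{sa}(t).$$ Here the step-sizes $\alpha_{sa}(t)$ are $\mathcal F_t$-measurable ($\alpha_{sa}(t)=0$ means that the entry $(s,a)$ is not updated at step $t$), the sampled successor state $X_{sa}(t)$ is $\mathcal F_{t+1}$-measurable, and on the event $\{\alpha_{sa}(t)\neq 0\}$ its conditional law given $\mathcal F_t$ is $P(\cdot\mid s,a)$. (The choice $\mathcal T=\{0,K-1\}$ uses the target estimate $Q(t)$ and the online estimate $Q(t+K-1)$.) Assume that $0\le\alpha_{sa}(t)\le 1$ for all $t,s,a$, and that there is a deterministic constant $C$ such that, with probability $1$, for every $(s,a)$, $$\sum_{t=0}^\infty\alpha_{sa}(t)^2\le C\qquad\text{and}\qquad\sum_{t=0}^\infty\alpha_{sa}(t)=\infty.$$ Then, with probability $1$, $Q_{sa}(t)\to Q^*(s,a)$ as $t\to\infty$ for every $(s,a)\in\mathcal S\times\mathcal A$. -/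

import Mathlib

open MeasureTheory ProbabilityTheory Filter Topology

/-- A finite discounted Markov decision process: transition law `P (· | s, a)`, reward `r (s, a)`
and discount factor `γ ∈ [0, 1)`. (The law of the first state is not needed for `Q^*`.) -/
structure DiscountedMDP (S A : Type*) where
  /-- `P s a s'` is the probability of reaching `s'` from `s` under action `a`. -/
  P : S → A → PMF S
  /-- The reward function. -/
  r : S → A → ℝ
  /-- The discount factor. -/
  γ : ℝ
  γ_nonneg : 0 ≤ γ
  γ_lt_one : γ < 1

namespace DiscountedMDP

variable {S A : Type*}

/-- The law of the state-action pair `(s_t, a_t)` when `(s_0, a_0) = (s, a)`, the next state is drawn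
from `P` and from time `1` on the actions are drawn from the policy `π`. -/
noncomputable def pairLaw (M : DiscountedMDP S A) (π : S → PMF A) (s : S) (a : A) :
    ℕ → PMF (S × A)
  | 0 => PMF.pure (s, a)
  | t + 1 => (M.pairLaw π s a t).bind fun x =>
      (M.P x.1 x.2).bind fun s' => (π s').map fun a' => (s', a')

/-- The expected reward at time `t`, `E_π [r (s_t, a_t) | s_0 = s, a_0 = a]`. -/
noncomputable def expReward [Fintype S] [Fintype A] (M : DiscountedMDP S A) (π : S → PMF A)
    (s : S) (a : A) (t : ℕ) : ℝ :=
  ∑ x : S × A, (M.pairLaw π s a t x).toReal * M.r x.1 x.2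

/-- The action-value function of a policy, `Q^π (s, a) = E_π [∑_t γ ^ t r (s_t, a_t)]`. The rewards
are bounded, so the expectation is taken term by term and the series converges absolutely
(`summable_qPolicy`). -/
noncomputable def qPolicy [Fintype S] [Fintype A] (M : DiscountedMDP S A) (π : S → PMF A)
    (s : S) (a : A) : ℝ :=
  ∑' t : ℕ, M.γ ^ t * M.expReward π s a t

/-- The optimal action-value function, `Q^* (s, a) = sup_π Q^π (s, a)`. The set of values is bounded
(`bddAbove_qPolicy`), so the supremum is a genuine one. -/
noncomputable def qStar [Fintype S] [Fintype A] (M : DiscountedMDP S A) (s : S) (a : A) : ℝ :=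
  ⨆ π : S → PMF A, M.qPolicy π s a

theorem abs_expReward_le [Fintype S] [Fintype A] (M : DiscountedMDP S A) (π : S → PMF A)
    (s : S) (a : A) (t : ℕ) : |M.expReward π s a t| ≤ ∑ x : S × A, |M.r x.1 x.2| := by
  refine (Finset.abs_sum_le_sum_abs _ _).trans (Finset.sum_le_sum fun x _ => ?_)
  rw [abs_mul, abs_of_nonneg ENNReal.toReal_nonneg]
  refine mul_le_of_le_one_left (abs_nonneg _) ?_
  exact ENNReal.toReal_le_of_le_ofReal zero_le_one (by simpa using PMF.coe_le_one _ x)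

theorem summable_qPolicy [Fintype S] [Fintype A] (M : DiscountedMDP S A) (π : S → PMF A)
    (s : S) (a : A) : Summable fun t : ℕ => M.γ ^ t * M.expReward π s a t := by
  refine Summable.of_norm_bounded
    ((summable_geometric_of_lt_one M.γ_nonneg M.γ_lt_one).mul_right (∑ x : S × A, |M.r x.1 x.2|))
    fun t => ?_
  rw [Real.norm_eq_abs, abs_mul, abs_of_nonneg (pow_nonneg M.γ_nonneg t)]
  exact mul_le_mul_of_nonneg_left (M.abs_expReward_le π s a t) (pow_nonneg M.γ_nonneg t)

theorem bddAbove_qPolicy [Fintype S] [Fintype A] (M : DiscountedMDP S A) (s : S) (a : A) :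
    BddAbove (Set.range fun π : S → PMF A => M.qPolicy π s a) := by
  refine ⟨∑' t : ℕ, M.γ ^ t * ∑ x : S × A, |M.r x.1 x.2|, ?_⟩
  rintro _ ⟨π, rfl⟩
  refine (M.summable_qPolicy π s a).tsum_le_tsum (fun t => ?_)
    ((summable_geometric_of_lt_one M.γ_nonneg M.γ_lt_one).mul_right _)
  exact mul_le_mul_of_nonneg_left ((le_abs_self _).trans (M.abs_expReward_le π s a t))
    (pow_nonneg M.γ_nonneg t)

end DiscountedMDP

/-- The MINTO target operator `G (Q_s) = max_a min_{j ∈ T} Q_{sa} (j)`; the argument `q a j` is the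
`j`-th of the `K` historical values of action `a` in the state at hand. -/
def mintoOp {A : Type*} [Fintype A] [Nonempty A] {K : ℕ} (T : Finset (Fin K)) (hT : T.Nonempty)
    (q : A → Fin K → ℝ) : ℝ :=
  Finset.univ.sup' Finset.univ_nonempty fun a : A => T.inf' hT fun j => q a j

/-- Tabular MINTO run on the MDP `M`, with stochastic and possibly asynchronous updates.
The tables `Q 0, …, Q (K - 1)` are the initial history, and `Q (t + K)` is the table after update
number `t`. That update reads the `K` tables `Q t, …, Q (t + K - 1)`, the last of which is the
current one (the online estimate). `α t ω s a` is the step-size with which the entry `(s, a)` is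
updated (`0` if it is not), and `X t ω s a` is the successor state used to update it. The
σ-algebra `ℱ t` is the information available just before the successors of update `t` are drawn. -/
structure IsMINTO {S A Ω : Type*} [Fintype S] [Fintype A] [Nonempty A] {mΩ : MeasurableSpace Ω}
    (M : DiscountedMDP S A) (μ : Measure Ω) (ℱ : Filtration ℕ mΩ)
    {K : ℕ} (T : Finset (Fin K)) (hT : T.Nonempty)
    (α : ℕ → Ω → S → A → ℝ) (X : ℕ → Ω → S → A → S) (Q : ℕ → Ω → S → A → ℝ) : Prop where
  /-- The initial tables, which may be random, are known at time `0`. -/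
  init_meas : ∀ k < K, ∀ s a, Measurable[ℱ 0] fun ω => Q k ω s a
  /-- The choice of the entries to update and of their step-sizes uses no future information. -/
  step_meas : ∀ t s a, Measurable[ℱ t] fun ω => α t ω s a
  next_meas : ∀ t s a s', MeasurableSet[ℱ (t + 1)] {ω | X t ω s a = s'}
  /-- If the entry `(s, a)` is updated, the successor has conditional law `P (· | s, a)`. -/
  next_law : ∀ t s a s', ∀ᵐ ω ∂μ, α t ω s a ≠ 0 →
    (μ⟦{ω' | X t ω' s a = s'} | ℱ t⟧) ω = (M.P s a s').toReal
  /-- The update `Q_{sa} ← Q_{sa} + α_{sa} (r + γ G (Q_{s'}) - Q_{sa})`. -/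
  update : ∀ t ω s a, Q (t + K) ω s a = Q (t + K - 1) ω s a + α t ω s a *
    (M.r s a + M.γ * mintoOp T hT (fun a' j => Q (t + j) ω (X t ω s a) a')
      - Q (t + K - 1) ω s a)

/-- The standard stochastic-approximation conditions on the step-sizes: they lie in `[0, 1]`, and
for some deterministic `C`, almost surely `∑_t α_{sa} (t) ^ 2 ≤ C` and `∑_t α_{sa} (t) = ∞` for
every `(s, a)`. -/
structure StepSizeCondition {S A Ω : Type*} {mΩ : MeasurableSpace Ω} (μ : Measure Ω)
    (α : ℕ → Ω → S → A → ℝ) : Prop where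
  mem_Icc : ∀ t ω s a, α t ω s a ∈ Set.Icc (0 : ℝ) 1
  sum_sq : ∃ C : ℝ, ∀ s a, ∀ᵐ ω ∂μ, ∀ n : ℕ, ∑ t ∈ Finset.range n, α t ω s a ^ 2 ≤ C
  sum_eq_top : ∀ s a, ∀ᵐ ω ∂μ,
    Tendsto (fun n : ℕ => ∑ t ∈ Finset.range n, α t ω s a) atTop atTop

/-! Write `z` for the error `Q - Q^*`. If all historical values of `(s', a')` lie within `D` of
`Q^*(s', a')`, so does their minimum, and the maximum over `a'` is then within `D` of `max Q^*(s',
·)`. The minimum therefore leaves the fixed point unbiased, and the expected MINTO target is within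
`γ D` of `Q^*` (`abs_mintoOp_sub_sup'_le`, `bellman_qStar`). The difference between sampled and
expected target, weighted by the step-sizes, is a finite sum of martingale transforms.
Square-summable steps make it a convergent series almost surely (`ae_exists_tendsto_sum_noise`). The
rest is pathwise: correcting the iterates by the remainder of that series removes the noise. Since
the step-sizes sum to infinity, each eventual bound on `z` improves by the factor `(1 + γ) / 2`
(`tendsto_zero_of_contracting_history`). -/

/-! ### Finite expectations and sup-norm estimates. -/

namespace PMF

variable {α β : Type*} [Fintype α] [Fintype β]

/-- The expectation of a real function under a probability mass function on a finite type. -/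
noncomputable def expect (p : PMF α) (f : α → ℝ) : ℝ :=
  ∑ x, (p x).toReal * f x

theorem sum_toReal (p : PMF α) : ∑ x, (p x).toReal = 1 := by
  rw [← ENNReal.toReal_sum fun x _ => p.apply_ne_top x, ← tsum_fintype (L := .unconditional α),
    p.tsum_coe, ENNReal.toReal_one]

theorem expect_pure (x : α) (f : α → ℝ) : (PMF.pure x).expect f = f x := by
  classical
  rw [expect, Finset.sum_eq_single x]
  · simp
  · intro y _ hy
    simp [hy]
  · simp

theorem expect_bind (p : PMF α) (k : α → PMF β) (f : β → ℝ) :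
    (p.bind k).expect f = p.expect fun x => (k x).expect f := by
  have h : ∀ y, ((p.bind k) y).toReal = ∑ x, (p x).toReal * (k x y).toReal := by
    intro y
    rw [bind_apply, tsum_fintype, ENNReal.toReal_sum]
    · simp only [ENNReal.toReal_mul]
    · exact fun x _ => ENNReal.mul_ne_top (p.apply_ne_top x) ((k x).apply_ne_top y)
  simp only [expect, h, Finset.sum_mul, Finset.mul_sum]
  rw [Finset.sum_comm]
  simp only [mul_assoc]

theorem expect_mono (p : PMF α) {f g : α → ℝ} (h : ∀ x, f x ≤ g x) : p.expect f ≤ p.expect g :=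
  Finset.sum_le_sum fun x _ => mul_le_mul_of_nonneg_left (h x) ENNReal.toReal_nonneg

theorem expect_const (p : PMF α) (c : ℝ) : p.expect (fun _ => c) = c := by
  rw [expect, ← Finset.sum_mul, p.sum_toReal, one_mul]

theorem expect_sub (p : PMF α) (f g : α → ℝ) :
    p.expect f - p.expect g = p.expect fun x => f x - g x := by
  simp only [expect, mul_sub, Finset.sum_sub_distrib]

theorem abs_expect_sub_le (p : PMF α) {f g : α → ℝ} {B : ℝ} (h : ∀ x, |f x - g x| ≤ B) :
    |p.expect f - p.expect g| ≤ B := by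
  rw [expect_sub, abs_le]
  constructor
  · exact (p.expect_const (-B)).ge.trans (p.expect_mono fun x => (abs_le.mp (h x)).1)
  · exact (p.expect_mono fun x => (abs_le.mp (h x)).2).trans (p.expect_const B).le

end PMF

theorem abs_sup'_sub_sup'_le {ι : Type*} {s : Finset ι} (hs : s.Nonempty) {f g : ι → ℝ} {B : ℝ}
    (h : ∀ i ∈ s, |f i - g i| ≤ B) : |s.sup' hs f - s.sup' hs g| ≤ B := by
  rw [abs_sub_le_iff]
  constructor <;> rw [sub_le_iff_le_add] <;> refine Finset.sup'_le hs _ fun i hi => ?_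
  · linarith [(abs_sub_le_iff.mp (h i hi)).1, Finset.le_sup' g hi]
  · linarith [(abs_sub_le_iff.mp (h i hi)).2, Finset.le_sup' f hi]

/-- A function on a finite type all of whose upper bounds shrink by a factor `γ < 1` is
nonpositive. -/
theorem nonpos_of_le_mul_of_forall_le {ι : Type*} [Finite ι] {γ : ℝ} (hγ : γ < 1) {f : ι → ℝ}
    (h : ∀ d, (∀ i, f i ≤ d) → ∀ i, f i ≤ γ * d) (i : ι) : f i ≤ 0 := by
  have : Nonempty ι := ⟨i⟩
  obtain ⟨m, hm⟩ := Finite.exists_max f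
  have := h (f m) hm m
  nlinarith [hm i]

/-! ### Bellman equations and the characterisation of `qStar`. -/

namespace DiscountedMDP

variable {S A : Type*}

/-- `pairLaw` appends transitions at the end, whereas the Bellman equation needs the first one split
off; associativity of `bind` exchanges the two. -/
theorem pairLaw_succ (M : DiscountedMDP S A) (π : S → PMF A) (s : S) (a : A) (t : ℕ) :
    M.pairLaw π s a (t + 1) =
      (M.P s a).bind fun s' => (π s').bind fun a' => M.pairLaw π s' a' t := by
  induction t with
  | zero => simp [pairLaw, PMF.pure_bind, PMF.map, Function.comp_def]
  | succ t ih =>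
    rw [pairLaw, ih]
    simp only [PMF.bind_bind]
    rfl

variable [Fintype S] [Fintype A]

theorem expReward_zero (M : DiscountedMDP S A) (π : S → PMF A) (s : S) (a : A) :
    M.expReward π s a 0 = M.r s a :=
  PMF.expect_pure (s, a) fun x => M.r x.1 x.2

theorem expReward_succ (M : DiscountedMDP S A) (π : S → PMF A) (s : S) (a : A) (t : ℕ) :
    M.expReward π s a (t + 1) =
      (M.P s a).expect fun s' => (π s').expect fun a' => M.expReward π s' a' t := by
  change (M.pairLaw π s a (t + 1)).expect (fun x => M.r x.1 x.2) = _
  rw [pairLaw_succ, PMF.expect_bind]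
  simp only [PMF.expect_bind]
  rfl

/-- The Bellman equation of a policy. -/
theorem qPolicy_eq (M : DiscountedMDP S A) (π : S → PMF A) (s : S) (a : A) :
    M.qPolicy π s a = M.r s a +
      M.γ * (M.P s a).expect fun s' => (π s').expect fun a' => M.qPolicy π s' a' := by
  have h : HasSum (fun t => M.γ ^ t * (M.P s a).expect fun s' => (π s').expect fun a' =>
      M.expReward π s' a' t)
      ((M.P s a).expect fun s' => (π s').expect fun a' => M.qPolicy π s' a') := by
    have h' : HasSum (fun t => (M.P s a).expect fun s' => (π s').expect fun a' =>
        M.γ ^ t * M.expReward π s' a' t)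
        ((M.P s a).expect fun s' => (π s').expect fun a' => M.qPolicy π s' a') :=
      hasSum_sum fun s' _ => (hasSum_sum fun a' _ =>
        (M.summable_qPolicy π s' a').hasSum.mul_left _).mul_left _
    convert h' using 2 with t
    simp only [PMF.expect, Finset.mul_sum, mul_left_comm]
  rw [qPolicy, (M.summable_qPolicy π s a).tsum_eq_zero_add, ← (h.mul_left M.γ).tsum_eq]
  simp only [pow_zero, one_mul, expReward_zero, expReward_succ, pow_succ', mul_assoc]

variable [Nonempty A]

/-- The Bellman optimality operator on action-value functions. -/
noncomputable def bellman (M : DiscountedMDP S A) (q : S → A → ℝ) (s : S) (a : A) : ℝ :=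
  M.r s a + M.γ * (M.P s a).expect fun s' => Finset.univ.sup' Finset.univ_nonempty (q s')

theorem exists_bellman_fixedPoint (M : DiscountedMDP S A) : ∃ q, M.bellman q = q := by
  have h : ContractingWith ⟨M.γ, M.γ_nonneg⟩ M.bellman := by
    refine ⟨M.γ_lt_one, LipschitzWith.of_dist_le_mul fun q q' => ?_⟩
    have h0 : 0 ≤ M.γ * dist q q' := mul_nonneg M.γ_nonneg dist_nonneg
    refine (dist_pi_le_iff h0).mpr fun s => (dist_pi_le_iff h0).mpr fun a => ?_
    rw [Real.dist_eq, bellman, bellman, add_sub_add_left_eq_sub, ← mul_sub, abs_mul,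
      abs_of_nonneg M.γ_nonneg]
    refine mul_le_mul_of_nonneg_left (PMF.abs_expect_sub_le _ fun s' =>
      abs_sup'_sub_sup'_le _ fun a' _ => ?_) M.γ_nonneg
    exact (dist_le_pi_dist (q s') (q' s') a').trans (dist_le_pi_dist q q' s')
  exact ⟨_, h.fixedPoint_isFixedPt⟩

/-- An average over actions is at most the maximum, so an upper bound `d` on `Q^π - q` propagates
through both Bellman equations to `γ * d`. -/
theorem qPolicy_le_of_bellman_eq (M : DiscountedMDP S A) {q : S → A → ℝ} (hq : M.bellman q = q)
    (π : S → PMF A) (s : S) (a : A) : M.qPolicy π s a ≤ q s a := by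
  rw [← sub_nonpos]
  refine nonpos_of_le_mul_of_forall_le M.γ_lt_one
    (f := fun x : S × A => M.qPolicy π x.1 x.2 - q x.1 x.2) ?_ (s, a)
  rintro d hd ⟨s, a⟩
  dsimp only
  rw [← hq, bellman, qPolicy_eq, add_sub_add_left_eq_sub, ← mul_sub, PMF.expect_sub]
  refine mul_le_mul_of_nonneg_left ?_ M.γ_nonneg
  refine (PMF.expect_mono _ fun s' => ?_).trans (PMF.expect_const _ d).le
  rw [sub_le_iff_le_add]
  refine (PMF.expect_mono _ fun a' => ?_).trans (PMF.expect_const _ _).le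
  linarith [hd (s', a'), Finset.le_sup' (q s') (Finset.mem_univ a')]

/-- The policy greedy for `q` works: for it the policy average of `q` is the maximum itself. -/
theorem exists_le_qPolicy_of_bellman_eq (M : DiscountedMDP S A) {q : S → A → ℝ}
    (hq : M.bellman q = q) : ∃ π, ∀ s a, q s a ≤ M.qPolicy π s a := by
  choose g hg using fun s => Finset.exists_mem_eq_sup' Finset.univ_nonempty (q s)
  refine ⟨fun s => PMF.pure (g s), fun s a => ?_⟩
  rw [← sub_nonpos]
  refine nonpos_of_le_mul_of_forall_le M.γ_lt_one
    (f := fun x : S × A => q x.1 x.2 - M.qPolicy (fun s => PMF.pure (g s)) x.1 x.2) ?_ (s, a)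
  rintro d hd ⟨s, a⟩
  dsimp only
  rw [← hq, bellman, qPolicy_eq, add_sub_add_left_eq_sub, ← mul_sub, PMF.expect_sub]
  refine mul_le_mul_of_nonneg_left ?_ M.γ_nonneg
  refine (PMF.expect_mono _ fun s' => ?_).trans (PMF.expect_const _ d).le
  rw [PMF.expect_pure, (hg s').2]
  exact hd (s', g s')

theorem qStar_eq_of_bellman_eq (M : DiscountedMDP S A) {q : S → A → ℝ} (hq : M.bellman q = q)
    (s : S) (a : A) : M.qStar s a = q s a := by
  obtain ⟨π, hπ⟩ := M.exists_le_qPolicy_of_bellman_eq hq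
  have : Nonempty (S → PMF A) := ⟨π⟩
  exact le_antisymm (ciSup_le fun π' => M.qPolicy_le_of_bellman_eq hq π' s a)
    ((hπ s a).trans (le_ciSup (M.bddAbove_qPolicy s a) π))

/-- The Bellman optimality equation. -/
theorem bellman_qStar (M : DiscountedMDP S A) : M.bellman M.qStar = M.qStar := by
  obtain ⟨q, hq⟩ := M.exists_bellman_fixedPoint
  have : M.qStar = q := funext₂ (M.qStar_eq_of_bellman_eq hq)
  rw [this, hq]

end DiscountedMDP

/-! ### Nonexpansiveness and measurability of the MINTO operator. -/

section mintoOp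

variable {A : Type*} [Fintype A] [Nonempty A] {K : ℕ} (T : Finset (Fin K)) (hT : T.Nonempty)

theorem abs_inf'_sub_le {ι : Type*} {s : Finset ι} (hs : s.Nonempty) {f : ι → ℝ} {c B : ℝ}
    (h : ∀ i ∈ s, |f i - c| ≤ B) : |s.inf' hs f - c| ≤ B := by
  obtain ⟨i, hi, heq⟩ := Finset.exists_mem_eq_inf' hs f
  exact heq ▸ h i hi

theorem abs_mintoOp_sub_sup'_le {q : A → Fin K → ℝ} {g : A → ℝ} {B : ℝ}
    (h : ∀ a j, |q a j - g a| ≤ B) :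
    |mintoOp T hT q - Finset.univ.sup' Finset.univ_nonempty g| ≤ B :=
  abs_sup'_sub_sup'_le _ fun a _ => abs_inf'_sub_le hT fun j _ => h a j

theorem abs_mintoOp_le {q : A → Fin K → ℝ} {B : ℝ} (h : ∀ a j, |q a j| ≤ B) :
    |mintoOp T hT q| ≤ B := by
  simpa using abs_mintoOp_sub_sup'_le T hT (g := fun _ => 0) (by simpa using h)

theorem measurable_mintoOp {Ω : Type*} {m : MeasurableSpace Ω} {q : Ω → A → Fin K → ℝ}
    (h : ∀ a j, Measurable fun ω => q ω a j) : Measurable fun ω => mintoOp T hT (q ω) := by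
  have h1 : ∀ a, Measurable fun ω => T.inf' hT fun j => q ω a j := by
    intro a
    have := Finset.inf'_induction hT (fun j ω => q ω a j) (p := fun f : Ω → ℝ => Measurable f)
      (fun f hf g hg => hf.inf hg) fun j _ => h a j
    convert this using 1
    ext ω
    simp
  have := Finset.measurable_sup' (Finset.univ_nonempty (α := A)) fun a _ => h1 a
  convert this using 1
  ext ω
  simp [mintoOp]

end mintoOp

/-! ### Deterministic convergence of averaging recursions. -/

/-- Once `|u n| ≤ c`, each step multiplies the excess `|y n| - c` by at most `1 - α n ≤ exp (-α n)`,
and the product of these factors tends to `0`. -/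
theorem eventually_abs_le_of_averaging {α y u : ℕ → ℝ} {c c' : ℝ} (hα : ∀ n, α n ∈ Set.Icc (0 : ℝ) 1)
    (hsum : Tendsto (fun n => ∑ k ∈ Finset.range n, α k) atTop atTop)
    (hy : ∀ n, y (n + 1) = (1 - α n) * y n + α n * u n)
    (hu : ∀ᶠ n in atTop, |u n| ≤ c) (hc : c < c') : ∀ᶠ n in atTop, |y n| ≤ c' := by
  obtain ⟨N, hN⟩ := eventually_atTop.mp hu
  have hstep : ∀ n ≥ N, |y (n + 1)| - c ≤ (1 - α n) * (|y n| - c) := by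
    intro n hn
    have h1 : |y (n + 1)| ≤ (1 - α n) * |y n| + α n * |u n| := by
      rw [hy]
      refine (abs_add_le _ _).trans_eq ?_
      rw [abs_mul, abs_mul, abs_of_nonneg (hα n).1, abs_of_nonneg (sub_nonneg.mpr (hα n).2)]
    nlinarith [mul_le_mul_of_nonneg_left (hN n hn) (hα n).1]
  -- The excess may be negative; truncating at `0` keeps the majorant nonnegative, as replacing `1 -
  -- α n` by `exp (-α n)` requires.
  set D : ℝ := max (|y N| - c) 0 with hD
  set s : ℕ → ℝ := fun n => ∑ k ∈ Finset.range n, α k with hs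
  have hbound : ∀ n ≥ N, |y n| - c ≤ D * Real.exp (s N - s n) := by
    intro n hn
    induction n, hn using Nat.le_induction with
    | base => simp [hD]
    | succ n hn ih =>
      have h1 : s N - s (n + 1) = -α n + (s N - s n) := by
        simp only [hs, Finset.sum_range_succ]
        ring
      have h2 : 0 ≤ D * Real.exp (s N - s n) := mul_nonneg (le_max_right _ _) (Real.exp_pos _).le
      calc |y (n + 1)| - c ≤ (1 - α n) * (|y n| - c) := hstep n hn
        _ ≤ (1 - α n) * (D * Real.exp (s N - s n)) :=
          mul_le_mul_of_nonneg_left ih (sub_nonneg.mpr (hα n).2)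
        _ ≤ Real.exp (-α n) * (D * Real.exp (s N - s n)) :=
          mul_le_mul_of_nonneg_right (Real.one_sub_le_exp_neg _) h2
        _ = D * Real.exp (s N - s (n + 1)) := by
          rw [h1, Real.exp_add]
          ring
  have hlim : Tendsto (fun n => D * Real.exp (s N - s n)) atTop (𝓝 0) := by
    have : Tendsto (fun n => s N - s n) atTop atBot := by
      simpa [sub_eq_add_neg] using
        tendsto_atBot_add_const_left atTop (s N) (tendsto_neg_atTop_atBot.comp hsum)
    simpa using (Real.tendsto_exp_atBot.comp this).const_mul D
  filter_upwards [hlim.eventually_lt_const (sub_pos.mpr hc), eventually_ge_atTop N] with n hn hnN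
  linarith [hbound n hnN]

/-- Asynchronous stochastic approximation of a fixed point (moved to the origin) by an update with
bounded memory that contracts the sup norm over the last `K` iterates. -/
theorem tendsto_zero_of_contracting_history {ι : Type*} [Finite ι] {K : ℕ} (hK : 0 < K) {γ : ℝ}
    (hγ0 : 0 ≤ γ) (hγ1 : γ < 1) {α u ν z : ℕ → ι → ℝ}
    (hα : ∀ t i, α t i ∈ Set.Icc (0 : ℝ) 1)
    (hsum : ∀ i, Tendsto (fun n => ∑ t ∈ Finset.range n, α t i) atTop atTop)
    (hν : ∀ i, ∃ l, Tendsto (fun n => ∑ t ∈ Finset.range n, ν t i) atTop (𝓝 l))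
    (hz : ∀ t i, z (t + K) i = z (t + K - 1) i + α t i * (u t i - z (t + K - 1) i) + ν t i)
    (hu : ∀ t B, (∀ j < K, ∀ i, |z (t + j) i| ≤ B) → ∀ i, |u t i| ≤ γ * B)
    (hbdd : ∃ B, ∀ t i, |z t i| ≤ B) (i : ι) : Tendsto (fun t => z t i) atTop (𝓝 0) := by
  obtain ⟨B₀, hB₀⟩ := hbdd
  have hB₀0 : 0 ≤ B₀ := (abs_nonneg _).trans (hB₀ 0 i)
  choose l hl using hν
  -- Minus the tail of the noise series. Then `z (n + K - 1) - e n` obeys a noise-free averaging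
  -- recursion with input `u n - e n`.
  set e : ℕ → ι → ℝ := fun n i => ∑ t ∈ Finset.range n, ν t i - l i with he
  have he0 : ∀ i, Tendsto (fun n => e n i) atTop (𝓝 0) := fun i => by
    simpa using (hl i).sub_const (l i)
  have key : ∀ D, 0 < D → (∀ᶠ t in atTop, ∀ i, |z t i| ≤ D) →
      ∀ᶠ t in atTop, ∀ i, |z t i| ≤ (1 + γ) / 2 * D := by
    intro D hD hev
    -- The slack `(1 + γ) / 2 * D - γ * D` equals `4 * δ`. Three `δ` are spent: on `e` in the input,
    -- on the strict inequality of the averaging lemma, and on adding `e` back.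
    set δ := (1 - γ) * D / 8 with hδ
    have hδ0 : 0 < δ := by
      have := mul_pos (sub_pos.mpr hγ1) hD
      positivity
    have hsmall : ∀ i, ∀ᶠ n in atTop, |e n i| ≤ δ := fun i => by
      filter_upwards [(he0 i).abs.eventually_lt_const (by simpa using hδ0)] with n hn using hn.le
    obtain ⟨N, hN⟩ := eventually_atTop.mp hev
    rw [eventually_all]
    intro i
    have h1 : ∀ᶠ n in atTop, |u n i - e n i| ≤ γ * D + δ := by
      filter_upwards [hsmall i, eventually_ge_atTop N] with n hn hnN
      exact (abs_sub _ _).trans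
        (add_le_add (hu n D (fun j _ i => hN _ (by omega) i) i) hn)
    have h2 := eventually_abs_le_of_averaging (y := fun n => z (n + K - 1) i - e n i)
      (u := fun n => u n i - e n i) (fun t => hα t i) (hsum i) (fun n => by
        have h3 : n + 1 + K - 1 = n + K := by omega
        simp only [h3, hz, he, Finset.sum_range_succ]
        ring) h1 (show γ * D + δ < γ * D + 2 * δ by linarith)
    rw [← map_add_atTop_eq_nat (K - 1), eventually_map]
    filter_upwards [h2, hsmall i] with n hn1 hn2
    rw [← Nat.add_sub_assoc hK]
    have h4 := abs_add_le (z (n + K - 1) i - e n i) (e n i)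
    rw [sub_add_cancel] at h4
    calc |z (n + K - 1) i| ≤ γ * D + 2 * δ + δ := by linarith
      _ ≤ (1 + γ) / 2 * D := by linarith
  -- The `+ 1` makes the initial bound positive, as `key` demands.
  have hiter : ∀ n : ℕ, ∀ᶠ t in atTop, ∀ i, |z t i| ≤ ((1 + γ) / 2) ^ n * (B₀ + 1) := by
    intro n
    induction n with
    | zero => exact .of_forall fun t i => by simpa using (hB₀ t i).trans (by linarith)
    | succ n ih =>
      rw [pow_succ', mul_assoc]
      exact key _ (by positivity) ih
  have hpow : Tendsto (fun n : ℕ => ((1 + γ) / 2) ^ n * (B₀ + 1)) atTop (𝓝 0) := by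
    simpa using (tendsto_pow_atTop_nhds_zero_of_lt_one (r := (1 + γ) / 2) (by linarith)
      (by linarith)).mul_const (B₀ + 1)
  rw [Metric.tendsto_atTop']
  intro ε hε
  obtain ⟨n, hn⟩ := (hpow.eventually_lt_const hε).exists
  obtain ⟨N, hN⟩ := eventually_atTop.mp (hiter n)
  exact ⟨N, fun t ht => by simpa using (hN t ht.le i).trans_lt hn⟩

/-! ### Almost sure convergence of martingale transforms. -/

/-- A martingale transform with increments `c t * Y t`, where `Y` is bounded noise and the
predictable coefficients `c` have bounded sums of squares, converges almost surely. -/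
theorem ae_exists_tendsto_sum_mul_of_condExp_eq_zero {Ω : Type*} {mΩ : MeasurableSpace Ω}
    {μ : Measure Ω} [IsProbabilityMeasure μ] {ℱ : Filtration ℕ mΩ} {c Y : ℕ → Ω → ℝ} {b C : ℝ}
    (hc : ∀ t, Measurable[ℱ t] (c t)) (hY : ∀ t, Measurable[ℱ (t + 1)] (Y t))
    (hcb : ∀ t ω, |c t ω| ≤ b) (hYb : ∀ t ω, |Y t ω| ≤ 1)
    (hcond : ∀ t, ∀ᵐ ω ∂μ, c t ω ≠ 0 → (μ[Y t | ℱ t]) ω = 0)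
    (hsq : ∀ᵐ ω ∂μ, ∀ n, ∑ t ∈ Finset.range n, c t ω ^ 2 ≤ C) :
    ∀ᵐ ω ∂μ, ∃ l, Tendsto (fun n => ∑ t ∈ Finset.range n, c t ω * Y t ω) atTop (𝓝 l) := by
  have hb : 0 ≤ b := by
    obtain ⟨ω⟩ : Nonempty Ω := μ.nonempty_of_neZero
    exact (abs_nonneg _).trans (hcb 0 ω)
  have hc' : ∀ t, Measurable (c t) := fun t => (hc t).mono (ℱ.le t) le_rfl
  have hY' : ∀ t, Measurable (Y t) := fun t => (hY t).mono (ℱ.le _) le_rfl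
  set W : ℕ → Ω → ℝ := fun n ω => ∑ t ∈ Finset.range n, c t ω * Y t ω with hW
  have hWmeas : ∀ n, Measurable[ℱ n] (W n) := fun n =>
    Finset.measurable_fun_sum _ fun t ht =>
      ((hc t).mono (ℱ.mono (Finset.mem_range.mp ht).le) le_rfl).mul
        ((hY t).mono (ℱ.mono (Finset.mem_range.mp ht)) le_rfl)
  have hWmeas' : ∀ n, Measurable (W n) := fun n => (hWmeas n).mono (ℱ.le n) le_rfl
  have hcY : ∀ t ω, |c t ω * Y t ω| ≤ b := fun t ω => by
    rw [abs_mul]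
    exact (mul_le_mul (hcb t ω) (hYb t ω) (abs_nonneg _) hb).trans_eq (mul_one b)
  -- This bound grows with `n` and serves integrability only; the uniform control is the
  -- second-moment bound `hW2C`.
  have hWb : ∀ n ω, |W n ω| ≤ n * b := fun n ω =>
    (Finset.abs_sum_le_sum_abs _ _).trans
      ((Finset.sum_le_sum fun t _ => hcY t ω).trans_eq (by simp))
  have hint : ∀ {f : Ω → ℝ} (B : ℝ), Measurable f → (∀ ω, |f ω| ≤ B) → Integrable f μ :=
    fun B hf h => Integrable.of_bound hf.aestronglyMeasurable B (.of_forall h)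
  have hYint : ∀ t, Integrable (Y t) μ := fun t => hint 1 (hY' t) (hYb t)
  have hcYint : ∀ t, Integrable (c t * Y t) μ := fun t => hint b ((hc' t).mul (hY' t)) (hcY t)
  have hWint : ∀ n, Integrable (W n) μ := fun n => hint _ (hWmeas' n) (hWb n)
  have hcY0 : ∀ t, μ[c t * Y t | ℱ t] =ᵐ[μ] 0 := by
    intro t
    filter_upwards [condExp_mul_of_stronglyMeasurable_left (hc t).stronglyMeasurable (hcYint t)
      (hYint t), hcond t] with ω h1 h2
    rw [h1, Pi.mul_apply, Pi.zero_apply, mul_eq_zero]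
    exact or_iff_not_imp_left.mpr h2
  have hmart : Martingale W ℱ μ := by
    refine martingale_of_condExp_sub_eq_zero_nat (fun n => (hWmeas n).stronglyMeasurable) hWint ?_
    intro t
    have : W (t + 1) - W t = c t * Y t := by
      ext ω
      simp [hW, Finset.sum_range_succ]
    rw [this]
    exact hcY0 t
  -- Orthogonality of increments: `W n` is known at time `n`, so it factors out of the conditional
  -- expectation.
  have hcross : ∀ n, ∫ ω, W n ω * (c n ω * Y n ω) ∂μ = 0 := by
    intro n
    have hprod : Integrable (W n * (c n * Y n)) μ :=
      hint (n * b * b) ((hWmeas' n).mul ((hc' n).mul (hY' n))) fun ω => by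
        rw [Pi.mul_apply, abs_mul]
        exact mul_le_mul (hWb n ω) (hcY n ω) (abs_nonneg _) (by positivity)
    have h1 : μ[W n * (c n * Y n) | ℱ n] =ᵐ[μ] 0 := by
      filter_upwards [condExp_mul_of_stronglyMeasurable_left (hWmeas n).stronglyMeasurable hprod
        (hcYint n), hcY0 n] with ω h1 h2
      rw [h1, Pi.mul_apply, h2, Pi.zero_apply, mul_zero]
    have h2 := integral_condExp (ℱ.le n) (μ := μ) (f := W n * (c n * Y n))
    rw [integral_congr_ae h1] at h2
    simpa using h2.symm
  have hc2int : ∀ t, Integrable (fun ω => c t ω ^ 2) μ := fun t =>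
    hint (b ^ 2) ((hc' t).pow_const 2) fun ω => by
      rw [abs_pow]
      exact pow_le_pow_left₀ (abs_nonneg _) (hcb t ω) 2
  have hcY2int : ∀ t, Integrable (fun ω => (c t ω * Y t ω) ^ 2) μ := fun t =>
    hint (b ^ 2) (((hc' t).mul (hY' t)).pow_const 2) fun ω => by
      rw [abs_pow]
      exact pow_le_pow_left₀ (abs_nonneg _) (hcY t ω) 2
  have hW2int : ∀ n, Integrable (fun ω => W n ω ^ 2) μ := fun n =>
    hint ((n * b) ^ 2) ((hWmeas' n).pow_const 2) fun ω => by
      rw [abs_pow]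
      exact pow_le_pow_left₀ (abs_nonneg _) (hWb n ω) 2
  have hcrossint : ∀ n, Integrable (fun ω => W n ω * (c n ω * Y n ω)) μ := fun n =>
    hint (n * b * b) ((hWmeas' n).mul ((hc' n).mul (hY' n))) fun ω => by
      rw [abs_mul]
      exact mul_le_mul (hWb n ω) (hcY n ω) (abs_nonneg _) (by positivity)
  have hW2 : ∀ n, ∫ ω, W n ω ^ 2 ∂μ ≤ ∑ t ∈ Finset.range n, ∫ ω, c t ω ^ 2 ∂μ := by
    intro n
    induction n with
    | zero => simp [hW]
    | succ n ih =>
      have h1 : ∀ ω, W (n + 1) ω ^ 2 =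
          W n ω ^ 2 + (2 * (W n ω * (c n ω * Y n ω)) + (c n ω * Y n ω) ^ 2) := fun ω => by
        simp only [hW, Finset.sum_range_succ]
        ring
      have h2 : ∫ ω, (c n ω * Y n ω) ^ 2 ∂μ ≤ ∫ ω, c n ω ^ 2 ∂μ :=
        integral_mono (hcY2int n) (hc2int n) fun ω => by
          dsimp only
          rw [mul_pow]
          exact mul_le_of_le_one_right (sq_nonneg _) ((sq_le_one_iff_abs_le_one _).mpr (hYb n ω))
      have h3 : Integrable (fun ω => 2 * (W n ω * (c n ω * Y n ω)) + (c n ω * Y n ω) ^ 2) μ :=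
        ((hcrossint n).const_mul 2).add (hcY2int n)
      rw [integral_congr_ae (.of_forall h1), integral_add (hW2int n) h3, integral_add ((hcrossint n).const_mul 2)
        (hcY2int n), integral_const_mul, hcross, Finset.sum_range_succ]
      linarith
  have hW2C : ∀ n, ∫ ω, W n ω ^ 2 ∂μ ≤ C := by
    intro n
    refine (hW2 n).trans ?_
    rw [← integral_finsetSum _ fun t _ => hc2int t]
    refine (integral_mono_ae (integrable_finsetSum _ fun t _ => hc2int t) (integrable_const C)
      (hsq.mono fun ω h => h n)).trans_eq (by simp)
  -- Doob's theorem needs an `L¹` bound, obtained from the `L²` one by `|W| ≤ 1 + W ^ 2`.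
  refine hmart.submartingale.exists_ae_tendsto_of_bdd (R := Real.toNNReal (1 + C)) fun n => ?_
  rw [eLpNorm_one_eq_lintegral_enorm, ← ofReal_integral_norm_eq_lintegral_enorm (hWint n)]
  refine ENNReal.ofReal_le_ofReal ?_
  calc ∫ ω, ‖W n ω‖ ∂μ ≤ ∫ ω, (1 + W n ω ^ 2) ∂μ :=
        integral_mono (hWint n).norm ((integrable_const 1).add (hW2int n)) fun ω => by
          dsimp only
          rw [Real.norm_eq_abs, ← sq_abs]
          nlinarith [sq_nonneg (|W n ω| - 1), abs_nonneg (W n ω)]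
    _ ≤ 1 + C := by
        rw [integral_add (integrable_const 1) (hW2int n)]
        simpa using hW2C n

/-! ### Measurability, boundedness and noise of the MINTO iterates. -/

namespace IsMINTO

variable {S A Ω : Type*} [Fintype S] [Fintype A] [Nonempty A] {mΩ : MeasurableSpace Ω}
  {M : DiscountedMDP S A} {μ : Measure Ω} {ℱ : Filtration ℕ mΩ} {K : ℕ} {T : Finset (Fin K)}
  {hT : T.Nonempty} {α : ℕ → Ω → S → A → ℝ} {X : ℕ → Ω → S → A → S} {Q : ℕ → Ω → S → A → ℝ}

/-- Evaluating a measurable random field at the sampled successor. -/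
theorem measurable_apply_next (hQ : IsMINTO M μ ℱ T hT α X Q) (t : ℕ) (s : S) (a : A)
    {h : Ω → S → ℝ} (hh : ∀ s', Measurable[ℱ (t + 1)] fun ω => h ω s') :
    Measurable[ℱ (t + 1)] fun ω => h ω (X t ω s a) := by
  classical
  have : (fun ω => h ω (X t ω s a)) =
      fun ω => ∑ s', {ω | X t ω s a = s'}.indicator (fun ω => h ω s') ω := by
    ext ω
    simp [Set.indicator_apply]
  rw [this]
  exact Finset.measurable_fun_sum _ fun s' _ => (hh s').indicator (hQ.next_meas t s a s')

/-- Update `t` reads tables up to `t + K - 1`, known at time `t`; its output, table `t + K`, also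
depends on `X t` and is known only at `t + 1`. -/
theorem measurable_table (hQ : IsMINTO M μ ℱ T hT α X Q) (t : ℕ) :
    ∀ n < t + K, ∀ s a, Measurable[ℱ t] fun ω => Q n ω s a := by
  have hK : 0 < K := hT.choose.pos
  induction t with
  | zero => simpa using hQ.init_meas
  | succ t ih =>
    intro n hn s a
    have hmono : ∀ {f : Ω → ℝ}, Measurable[ℱ t] f → Measurable[ℱ (t + 1)] f :=
      fun h => h.mono (ℱ.mono t.le_succ) le_rfl
    obtain hn | rfl : n < t + K ∨ n = t + K := by omega
    · exact hmono (ih n hn s a)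
    · simp only [hQ.update]
      have hx := hmono (ih (t + K - 1) (by omega) s a)
      have hG := hQ.measurable_apply_next t s a
        (h := fun ω s' => mintoOp T hT fun a' j => Q (t + j) ω s' a') fun s' =>
          measurable_mintoOp (m := ℱ (t + 1)) T hT fun a' j =>
            hmono (ih (t + j) (by omega) s' a')
      exact hx.add ((hmono (hQ.step_meas t s a)).mul
        (((hG.const_mul M.γ).const_add (M.r s a)).sub hx))

/-- The tables stay bounded along every sample path. -/
theorem exists_forall_abs_le (hQ : IsMINTO M μ ℱ T hT α X Q) (hα : StepSizeCondition μ α)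
    (ω : Ω) : ∃ B, ∀ t s a, |Q t ω s a| ≤ B := by
  have hK : 0 < K := hT.choose.pos
  obtain ⟨R, hR⟩ : ∃ R, ∀ x : S × A, |M.r x.1 x.2| ≤ R :=
    (Set.finite_range _).bddAbove.imp fun R h x => h ⟨x, rfl⟩
  obtain ⟨I, hI⟩ : ∃ I, ∀ x : Fin K × S × A, |Q x.1 ω x.2.1 x.2.2| ≤ I :=
    (Set.finite_range _).bddAbove.imp fun R h x => h ⟨x, rfl⟩
  have hγ := sub_pos.mpr M.γ_lt_one
  -- `R / (1 - γ)` is the least `B` with `R + γ * B ≤ B`, so targets stay within `B` and updates are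
  -- convex combinations.
  set B := max I (R / (1 - M.γ)) with hB
  have hRB : R ≤ B * (1 - M.γ) := (div_le_iff₀ hγ).mp (le_max_right _ _)
  refine ⟨B, fun t => ?_⟩
  induction t using Nat.strong_induction_on with
  | _ n ih =>
    intro s a
    obtain hn | hn := lt_or_ge n K
    · exact (hI (⟨n, hn⟩, s, a)).trans (le_max_left _ _)
    · obtain ⟨t, rfl⟩ := Nat.exists_eq_add_of_le' hn
      obtain ⟨h0, h1⟩ := hα.mem_Icc t ω s a
      have hG : |mintoOp T hT fun a' j => Q (t + j) ω (X t ω s a) a'| ≤ B :=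
        abs_mintoOp_le T hT fun a' j => ih _ (by omega) _ _
      have hx := ih (t + K - 1) (by omega) s a
      have hr := hR (s, a)
      rw [hQ.update]
      set G := mintoOp T hT fun a' j => Q (t + j) ω (X t ω s a) a'
      have htarget : |M.r s a + M.γ * G| ≤ B := by
        refine (abs_add_le _ _).trans ?_
        rw [abs_mul, abs_of_nonneg M.γ_nonneg]
        linarith [mul_le_mul_of_nonneg_left hG M.γ_nonneg]
      rw [abs_le] at hx htarget ⊢
      constructor <;> nlinarith [mul_le_mul_of_nonneg_left htarget.1 h0,
        mul_le_mul_of_nonneg_left htarget.2 h0, mul_le_mul_of_nonneg_left hx.1 (sub_nonneg.mpr h1),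
        mul_le_mul_of_nonneg_left hx.2 (sub_nonneg.mpr h1)]

theorem condExp_indicator_next_sub [IsProbabilityMeasure μ] (hQ : IsMINTO M μ ℱ T hT α X Q)
    (t : ℕ) (s : S) (a : A) (s' : S) : ∀ᵐ ω ∂μ, α t ω s a ≠ 0 →
      (μ[fun ω => {ω | X t ω s a = s'}.indicator (fun _ => (1 : ℝ)) ω - (M.P s a s').toReal |
        ℱ t]) ω = 0 := by
  have hint : Integrable ({ω | X t ω s a = s'}.indicator fun _ => (1 : ℝ)) μ :=
    (integrable_const 1).indicator (ℱ.le _ _ (hQ.next_meas t s a s'))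
  filter_upwards [hQ.next_law t s a s',
    condExp_sub hint (integrable_const (M.P s a s').toReal) (ℱ t)] with ω h1 h2 h0
  refine h2.trans ?_
  rw [Pi.sub_apply, h1 h0, condExp_const (ℱ.le t), sub_self]

/-- The accumulated sampling noise converges almost surely. -/
theorem ae_exists_tendsto_sum_noise [IsProbabilityMeasure μ] (hQ : IsMINTO M μ ℱ T hT α X Q)
    (hα : StepSizeCondition μ α) (s : S) (a : A) :
    ∀ᵐ ω ∂μ, ∃ l, Tendsto (fun n => ∑ t ∈ Finset.range n, α t ω s a * (M.γ *
      (mintoOp T hT (fun a' j => Q (t + j) ω (X t ω s a) a') -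
        (M.P s a).expect fun s' => mintoOp T hT fun a' j => Q (t + j) ω s' a')))
      atTop (𝓝 l) := by
  classical
  set G : ℕ → Ω → S → ℝ := fun t ω s' => mintoOp T hT fun a' j => Q (t + j) ω s' a' with hG
  have hGmeas : ∀ t s', Measurable[ℱ t] fun ω => G t ω s' := fun t s' =>
    measurable_mintoOp (m := ℱ t) T hT fun a' j => hQ.measurable_table t _ (by omega) s' a'
  -- The noise splits over successors `s'` as `G t ω s'`, known at time `t`, times the centred
  -- indicator `Y s' t`.
  set Y : S → ℕ → Ω → ℝ := fun s' t ω =>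
    {ω | X t ω s a = s'}.indicator (fun _ => (1 : ℝ)) ω - (M.P s a s').toReal with hY
  obtain ⟨C, hC⟩ := hα.sum_sq
  -- The bound on the tables depends on `ω`, since the initial tables need be neither bounded nor
  -- integrable. Clamping `G` at each level `m` gives bounded coefficients; on a given path the
  -- clamp is inactive for large `m`.
  have htrunc : ∀ s' (m : ℕ), ∀ᵐ ω ∂μ, ∃ l, Tendsto (fun n => ∑ t ∈ Finset.range n,
      α t ω s a * max (-(m : ℝ)) (min m (G t ω s')) * Y s' t ω) atTop (𝓝 l) := by
    intro s' m
    have hclamp : ∀ x : ℝ, |max (-(m : ℝ)) (min m x)| ≤ m := fun x =>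
      abs_le.mpr ⟨le_max_left _ _, max_le (by linarith [m.cast_nonneg (α := ℝ)]) (min_le_left _ _)⟩
    refine ae_exists_tendsto_sum_mul_of_condExp_eq_zero (ℱ := ℱ) (b := m) (C := C * m ^ 2)
      (fun t => ?_) (fun t => ?_) (fun t ω => ?_) (fun t ω => ?_) (fun t => ?_) ?_
    · exact (hQ.step_meas t s a).mul (measurable_const.max (measurable_const.min (hGmeas t s')))
    · exact (measurable_const.indicator (hQ.next_meas t s a s')).sub measurable_const
    · obtain ⟨h0, h1⟩ := hα.mem_Icc t ω s a
      rw [abs_mul, abs_of_nonneg h0]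
      exact (mul_le_of_le_one_left (abs_nonneg _) h1).trans (hclamp _)
    · have hp0 : 0 ≤ (M.P s a s').toReal := ENNReal.toReal_nonneg
      have hp1 : (M.P s a s').toReal ≤ 1 :=
        ENNReal.toReal_le_of_le_ofReal zero_le_one (by simpa using (M.P s a).coe_le_one s')
      simp only [hY, Set.indicator_apply]
      split_ifs <;> rw [abs_le] <;> constructor <;> linarith
    · filter_upwards [hQ.condExp_indicator_next_sub t s a s'] with ω h h0
      exact h (left_ne_zero_of_mul h0)
    · filter_upwards [hC s a] with ω h n
      refine le_trans ?_ (mul_le_mul_of_nonneg_right (h n) (sq_nonneg (m : ℝ)))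
      rw [Finset.sum_mul]
      refine Finset.sum_le_sum fun t _ => ?_
      rw [mul_pow]
      exact mul_le_mul_of_nonneg_left (sq_le_sq.mpr ((hclamp _).trans (le_abs_self _)))
        (sq_nonneg _)
  filter_upwards [ae_all_iff.mpr fun s' => ae_all_iff.mpr (htrunc s')] with ω hω
  obtain ⟨B, hB⟩ := hQ.exists_forall_abs_le hα ω
  obtain ⟨m, hm⟩ := exists_nat_ge B
  choose l hl using fun s' => hω s' m
  refine ⟨M.γ * ∑ s', l s', ((tendsto_finsetSum _ fun s' _ => hl s').const_mul M.γ).congr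
    fun n => ?_⟩
  have hclamp : ∀ t s', max (-(m : ℝ)) (min m (G t ω s')) = G t ω s' := fun t s' => by
    have := abs_le.mp ((abs_mintoOp_le T hT fun a' j => hB (t + j) s' a').trans hm)
    rw [min_eq_right this.2, max_eq_right this.1]
  rw [Finset.sum_comm, Finset.mul_sum]
  refine Finset.sum_congr rfl fun t _ => ?_
  have hsum : ∑ s', G t ω s' * Y s' t ω = G t ω (X t ω s a) - (M.P s a).expect (G t ω) := by
    simp [hY, PMF.expect, mul_sub, Set.indicator_apply, mul_comm (M.P s a _).toReal]
  simp only [hclamp, mul_assoc, ← Finset.mul_sum, hsum]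
  ring

end IsMINTO

/-! ### Assembly of the convergence theorem. -/

theorem mainTheorem1 {S A Ω : Type*} [Fintype S] [Fintype A] [Nonempty A]
    {mΩ : MeasurableSpace Ω} (μ : Measure Ω) [IsProbabilityMeasure μ] (ℱ : Filtration ℕ mΩ)
    (M : DiscountedMDP S A) {K : ℕ} (T : Finset (Fin K)) (hT : T.Nonempty)
    (α : ℕ → Ω → S → A → ℝ) (X : ℕ → Ω → S → A → S) (Q : ℕ → Ω → S → A → ℝ)
    (hQ : IsMINTO M μ ℱ T hT α X Q) (hα : StepSizeCondition μ α) :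
    ∀ᵐ ω ∂μ, ∀ s a, Tendsto (fun t => Q t ω s a) atTop (𝓝 (M.qStar s a)) := by
  filter_upwards [ae_all_iff.mpr fun s => ae_all_iff.mpr (hα.sum_eq_top s),
    ae_all_iff.mpr fun s => ae_all_iff.mpr (hQ.ae_exists_tendsto_sum_noise hα s)]
    with ω hsum hnoise s a
  obtain ⟨B, hB⟩ := hQ.exists_forall_abs_le hα ω
  obtain ⟨B', hB'⟩ : ∃ B', ∀ x : S × A, |M.qStar x.1 x.2| ≤ B' :=
    (Set.finite_range _).bddAbove.imp fun R h x => h ⟨x, rfl⟩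
  rw [← tendsto_sub_nhds_zero_iff]
  refine tendsto_zero_of_contracting_history (ι := S × A)
    (α := fun t x => α t ω x.1 x.2) (z := fun t x => Q t ω x.1 x.2 - M.qStar x.1 x.2)
    (u := fun t x => M.r x.1 x.2 + M.γ * ((M.P x.1 x.2).expect fun s' =>
      mintoOp T hT fun a' j => Q (t + j) ω s' a') - M.qStar x.1 x.2)
    (ν := fun t x => α t ω x.1 x.2 * (M.γ *
      (mintoOp T hT (fun a' j => Q (t + j) ω (X t ω x.1 x.2) a') -
        (M.P x.1 x.2).expect fun s' => mintoOp T hT fun a' j => Q (t + j) ω s' a')))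
    hT.choose.pos M.γ_nonneg M.γ_lt_one (fun t x => hα.mem_Icc t ω x.1 x.2)
    (fun x => hsum x.1 x.2) (fun x => hnoise x.1 x.2) (fun t x => ?_) (fun t D hD x => ?_)
    ⟨B + B', fun t x => (abs_sub _ _).trans (add_le_add (hB t x.1 x.2) (hB' x))⟩ (s, a)
  · rw [hQ.update]
    ring
  -- Expanding `Q^*` by its Bellman equation cancels the reward and leaves `γ` times a difference of
  -- expectations.
  · rw [← M.bellman_qStar, DiscountedMDP.bellman, add_sub_add_left_eq_sub, ← mul_sub, abs_mul,
      abs_of_nonneg M.γ_nonneg]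
    exact mul_le_mul_of_nonneg_left (PMF.abs_expect_sub_le _ fun s' =>
      abs_mintoOp_sub_sup'_le T hT fun a' j => hD j j.2 (s', a')) M.γ_nonneg
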